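/- Let $n\ge 0$, and for every analysis cycle $m=1,2,\ldots$ let there be given a linear (affine) model $\mathcal M^{(m)}(u)=A^{(m)}u+b^{(m)}$ with $A^{(m)}\in\mathbb R^{n\times n}$, $b^{(m)}\in\mathbb R^n$, a data vector $d^{(m)}\in\mathbb R^{q_m}$, an observation matrix $H^{(m)}\in\mathbb R^{q_m\times n}$, and a symmetric positive definite data error covariance $R^{(m)}\in\mathbb R^{q_m\times q_m}$. On a probability space, let $U^{(0)}_k$ ($k\ge1$) be random vectors with law $N(\mu_0,Q_0)$ on $\mathbb R^n$, where $Q_0$ is symmetric positive semidefinite, and let $D^{(m)}_k$ ($m,k\ge1$) be random vectors with law $N(d^{(m)},R^{(m)})$ on $\mathbb R^{q_m}$, such that all the $U^{(0)}_k$ and $D^{(m)}_k$ together are mutually independent. For a positive semidefinite matrix $Q\in\mathbb R^{n\times n}$ put $$K^{(m)}(Q)=Q(H^{(m)})^{\mathrm T}\bigl(H^{(m)}Q(H^{(m)})^{\mathrm T}+R^{(m)}\bigr)^{-1}.$$ *EnKF ensemble.* For an ensemble size $N\ge1$ put $X^{(0)}_k=X^{(0),a}_k=U^{(0)}_k$,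 $k=1,\ldots,N$, and for $m\ge1$ and $k=1,\ldots,N$ $$X^{(m)}_k=\mathcal M^{(m)}\bigl(X^{(m-1),a}_k\bigr),\qquad X^{(m),a}_k=X^{(m)}_k+K^{(m)}\bigl(Q^{(m)}_N\bigr)\bigl(D^{(m)}_k-H^{(m)}X^{(m)}_k\bigr),$$ where $Q^{(m)}_N=\frac1{N-1}\sum_{k=1}^N(X^{(m)}_k-\overline X^{(m)})(X^{(m)}_k-\overline X^{(m)})^{\mathrm T}$, $\overline X^{(m)}=\frac1N\sum_{k=1}^NX^{(m)}_k$, is the sample covariance (read as $0$ for $N=1$). *Reference ensemble.* Put $U^{(0),a}_k=U^{(0)}_k$, and for $m\ge1$ and all $k\ge1$ $$U^{(m)}_k=\mathcal M^{(m)}\bigl(U^{(m-1),a}_k\bigr),\qquad U^{(m),a}_k=U^{(m)}_k+K^{(m)}\bigl(Q^{(m)}\bigr)\bigl(D^{(m)}_k-H^{(m)}U^{(m)}_k\bigr),$$ where $Q^{(m)}=\operatorname{Cov}(U^{(m)}_1)$ is the exact covariance, which is the same for all members. Then for every $m\ge0$: 1. For every $N\ge 1$ the pairs $[X^{(m)}_k;U^{(m)}_k]$,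 $k=1,\ldots,N$, are exchangeable, that is, their joint distribution is invariant under every permutation of the indices $1,\ldots,N$; and so are the pairs $[X^{(m),a}_k;U^{(m),a}_k]$, $k=1,\ldots,N$. 2. For every $1\le p<\infty$, the random vectors $X^{(m)}_1$ (for every $N$), $U^{(m)}_1$, $X^{(m),a}_1$ (for every $N$) and $U^{(m),a}_1$ are in $L^p$, and as $N\to\infty$ $$X^{(m)}_1\to U^{(m)}_1\quad\text{and}\quad X^{(m),a}_1\to U^{(m),a}_1\quad\text{in }L^p,$$ that is, $E\bigl(|X^{(m)}_1-U^{(m)}_1|^p\bigr)^{1/p}\to0$ and $E\bigl(|X^{(m),a}_1-U^{(m),a}_1|^p\bigr)^{1/p}\to0$ with the Euclidean norm $|\cdot|$. -/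

import Mathlib

open MeasureTheory ProbabilityTheory Filter Topology

/-- The deterministic data of a sequential data assimilation problem with state space `ℝⁿ` and
linear (affine) models. The analysis cycles are numbered `1, 2, 3, …`, and the entry with index `m`
belongs to the analysis cycle `m + 1`: the model of this cycle is `u ↦ A m u + b m`, the data vector
is `d m ∈ ℝ ^ obsDim m`, the observation matrix is `H m` and the data error covariance is `R m`. -/
structure AssimilationProblem (n : ℕ) where
  A : ℕ → Matrix (Fin n) (Fin n) ℝ
  b : ℕ → EuclideanSpace ℝ (Fin n)
  obsDim : ℕ → ℕ
  d : (m : ℕ) → EuclideanSpace ℝ (Fin (obsDim m))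
  H : (m : ℕ) → Matrix (Fin (obsDim m)) (Fin n) ℝ
  R : (m : ℕ) → Matrix (Fin (obsDim m)) (Fin (obsDim m)) ℝ

noncomputable section

/-- The product `M v` of a matrix and a column vector, in Euclidean spaces. -/
def matVec {n q : ℕ} (M : Matrix (Fin q) (Fin n) ℝ) (v : EuclideanSpace ℝ (Fin n)) :
    EuclideanSpace ℝ (Fin q) :=
  WithLp.toLp 2 (M.mulVec v.ofLp)

/-- The model of the cycle `m + 1`. -/
def AssimilationProblem.model {n : ℕ} (S : AssimilationProblem n) (m : ℕ)
    (u : EuclideanSpace ℝ (Fin n)) : EuclideanSpace ℝ (Fin n) :=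
  matVec (S.A m) u + S.b m

/-- The sample mean of an ensemble. -/
def sampleMean {n N : ℕ} (x : Fin N → EuclideanSpace ℝ (Fin n)) : EuclideanSpace ℝ (Fin n) :=
  (N : ℝ)⁻¹ • ∑ k, x k

/-- The sample covariance `(N - 1)⁻¹ ∑ₖ (xₖ - x̄) (xₖ - x̄)ᵀ` of an ensemble. The subtraction is
that of `ℝ`; for `N = 1` the sum vanishes and so does the value. -/
def sampleCov {n N : ℕ} (x : Fin N → EuclideanSpace ℝ (Fin n)) : Matrix (Fin n) (Fin n) ℝ :=
  ((N : ℝ) - 1)⁻¹ •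
    ∑ k, Matrix.vecMulVec (x k - sampleMean x).ofLp (x k - sampleMean x).ofLp

/-- The covariance matrix of a random vector. -/
def covMat {Ω : Type*} [MeasurableSpace Ω] (P : Measure Ω) {n : ℕ}
    (V : Ω → EuclideanSpace ℝ (Fin n)) : Matrix (Fin n) (Fin n) ℝ :=
  Matrix.of fun i j => cov[fun ω => V ω i, fun ω => V ω j; P]

/-- The Kalman gain `Q Hᵀ (H Q Hᵀ + R)⁻¹`. -/
def kalmanGain {n q : ℕ} (H : Matrix (Fin q) (Fin n) ℝ) (R : Matrix (Fin q) (Fin q) ℝ)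
    (Q : Matrix (Fin n) (Fin n) ℝ) : Matrix (Fin n) (Fin q) ℝ :=
  Q * H.transpose * (H * Q * H.transpose + R)⁻¹

/-- The analysis `x + K (y - H x)` of a single state `x` with (perturbed) data `y` and gain `K`. -/
def analysisUpdate {n q : ℕ} (H : Matrix (Fin q) (Fin n) ℝ) (K : Matrix (Fin n) (Fin q) ℝ)
    (x : EuclideanSpace ℝ (Fin n)) (y : EuclideanSpace ℝ (Fin q)) : EuclideanSpace ℝ (Fin n) :=
  x + matVec K (y - matVec H x)

namespace AssimilationProblem

variable {n : ℕ} (S : AssimilationProblem n)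

/-- The ensemble after the analysis of the cycle `m` of the ensemble Kalman filter, started from the
initial ensemble `x₀` and run with the perturbed data ensembles `D` (`D m` is used in the cycle
`m + 1`). For `m = 0` it is the initial ensemble. -/
def enkfAnalysis {N : ℕ} (x₀ : Fin N → EuclideanSpace ℝ (Fin n))
    (D : (m : ℕ) → Fin N → EuclideanSpace ℝ (Fin (S.obsDim m))) :
    ℕ → Fin N → EuclideanSpace ℝ (Fin n)
  | 0 => x₀
  | m + 1 =>
    let x : Fin N → EuclideanSpace ℝ (Fin n) := fun k => S.model m (enkfAnalysis x₀ D m k)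
    fun k => analysisUpdate (S.H m) (kalmanGain (S.H m) (S.R m) (sampleCov x)) (x k) (D m k)

/-- The ensemble `X⁽ᵐ⁾`: the initial ensemble for `m = 0`, and for `m ≥ 1` the forecast ensemble of
the cycle `m`, to which the analysis of this cycle is applied. -/
def enkfForecast {N : ℕ} (x₀ : Fin N → EuclideanSpace ℝ (Fin n))
    (D : (m : ℕ) → Fin N → EuclideanSpace ℝ (Fin (S.obsDim m))) :
    ℕ → Fin N → EuclideanSpace ℝ (Fin n)
  | 0 => x₀
  | m + 1 => fun k => S.model m (S.enkfAnalysis x₀ D m k)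

variable {Ω : Type*} [MeasurableSpace Ω] (P : Measure Ω)

/-- The reference members after the analysis of the cycle `m`. They are obtained like the members of
the ensemble Kalman filter, except that the gain is computed from the exact covariance of the
reference forecast. The members are identically distributed, and the covariance is written as
that of the first one. -/
def refAnalysis (U₀ : ℕ → Ω → EuclideanSpace ℝ (Fin n))
    (D : (m : ℕ) → ℕ → Ω → EuclideanSpace ℝ (Fin (S.obsDim m))) :
    ℕ → ℕ → Ω → EuclideanSpace ℝ (Fin n)
  | 0 => U₀
  | m + 1 =>
    let U : ℕ → Ω → EuclideanSpace ℝ (Fin n) := fun k ω => S.model m (refAnalysis U₀ D m k ω)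
    fun k ω =>
      analysisUpdate (S.H m) (kalmanGain (S.H m) (S.R m) (covMat P (U 0))) (U k ω) (D m k ω)

/-- The reference members `U⁽ᵐ⁾`: the initial ones for `m = 0`, and for `m ≥ 1` the forecast of the
cycle `m`. -/
def refForecast (U₀ : ℕ → Ω → EuclideanSpace ℝ (Fin n))
    (D : (m : ℕ) → ℕ → Ω → EuclideanSpace ℝ (Fin (S.obsDim m))) :
    ℕ → ℕ → Ω → EuclideanSpace ℝ (Fin n)
  | 0 => U₀
  | m + 1 => fun k ω => S.model m (S.refAnalysis P U₀ D m k ω)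

/-- The random analysis ensemble of size `N` in the cycle `m`, where the initial ensemble and the
perturbed data are the first `N` terms of the given sequences. -/
def randomAnalysis (U₀ : ℕ → Ω → EuclideanSpace ℝ (Fin n))
    (D : (m : ℕ) → ℕ → Ω → EuclideanSpace ℝ (Fin (S.obsDim m)))
    (N m : ℕ) (k : Fin N) (ω : Ω) : EuclideanSpace ℝ (Fin n) :=
  S.enkfAnalysis (fun j : Fin N => U₀ j ω) (fun l (j : Fin N) => D l j ω) m k

/-- The random ensemble `X⁽ᵐ⁾` of size `N`, where the initial ensemble and the perturbed data
are the first `N` terms of the given sequences. -/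
def randomForecast (U₀ : ℕ → Ω → EuclideanSpace ℝ (Fin n))
    (D : (m : ℕ) → ℕ → Ω → EuclideanSpace ℝ (Fin (S.obsDim m)))
    (N m : ℕ) (k : Fin N) (ω : Ω) : EuclideanSpace ℝ (Fin n) :=
  S.enkfForecast (fun j : Fin N => U₀ j ω) (fun l (j : Fin N) => D l j ω) m k

end AssimilationProblem

/-- Exchangeability of finitely many random elements: the joint distribution is invariant under
permutations of the indices. -/
def Exchangeable {Ω E : Type*} [MeasurableSpace Ω] [MeasurableSpace E] {N : ℕ}
    (Z : Fin N → Ω → E) (P : Measure Ω) : Prop :=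
  ∀ π : Equiv.Perm (Fin N),
    IdentDistrib (fun ω (k : Fin N) => Z (π k) ω) (fun ω (k : Fin N) => Z k ω) P P

/-- Convergence `V N → W` in `Lᵖ(Ω; E)`, where all the random elements belong to this space. -/
def ConvergesInLp {Ω E : Type*} [MeasurableSpace Ω] [NormedAddCommGroup E]
    (V : ℕ → Ω → E) (W : Ω → E) (p : ENNReal) (P : Measure Ω) : Prop :=
  (∀ N, MemLp (V N) p P) ∧ MemLp W p P ∧
    Tendsto (fun N => eLpNorm (V N - W) p P) atTop (𝓝 0)

end

/-! Both ensembles are driven by the same inputs, so the first members differ only because one gain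
is built from the sample covariance and the other from the exact covariance. The convergence is
proved by induction on the cycle. Averages of `f (X k)` over the ensemble differ from averages of `f
(U k)` by at most the `Lᵖ` distance of `f (X 1)` and `f (U 1)`, because the pairs are exchangeable.
The reference members are pairwise independent and identically distributed, so their averages obey
the `Lᵖ` law of large numbers (`ConvergesInEveryLp.average`). Hence the sample covariance converges
to the exact one (`ConvergesInEveryLp.sampleCov`). The inverse in the gain is bounded in terms of
`R` alone (`Matrix.PosDef.abs_inv_add_posSemidef_le`), so the gain converges too, and the analysis
step consists of sums and products of convergent sequences. Products halve the exponent, which is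
why the induction carries all finite `p` at once.

Exchangeability needs no limit: the ensemble of pairs is a measurable, permutation-equivariant
function of the inputs, whose joint law is unchanged when members are relabelled. -/

/-! ### Calculus of convergence in all `Lᵖ`, `1 ≤ p < ∞`. -/

/-- Convergence in `Lᵖ` for every finite exponent `p ≥ 1`. -/
def ConvergesInEveryLp {Ω E : Type*} [MeasurableSpace Ω] [NormedAddCommGroup E]
    (V : ℕ → Ω → E) (W : Ω → E) (P : Measure Ω) : Prop :=
  ∀ p : ENNReal, 1 ≤ p → p ≠ ⊤ → ConvergesInLp V W p P

theorem ENNReal.holderTriple_two_mul {p : ENNReal} : ENNReal.HolderTriple (2 * p) (2 * p) p := by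
  constructor
  rw [ENNReal.mul_inv (by simp) (by simp), ← add_mul, ENNReal.inv_two_add_inv_two, one_mul]

theorem EuclideanSpace.norm_le_sum_norm {ι : Type*} [Fintype ι] (x : EuclideanSpace ℝ ι) :
    ‖x‖ ≤ ∑ i, ‖x i‖ := by
  rw [EuclideanSpace.norm_eq]
  exact Real.sqrt_le_iff.2 ⟨by positivity,
    Finset.sum_sq_le_sq_sum_of_nonneg fun i _ => norm_nonneg _⟩

namespace ConvergesInEveryLp

variable {Ω E : Type*} [MeasurableSpace Ω] [NormedAddCommGroup E] {P : Measure Ω}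

theorem memLp {V : ℕ → Ω → E} {W : Ω → E} (h : ConvergesInEveryLp V W P) (N : ℕ) {p : ENNReal}
    (hp : 1 ≤ p) (hp' : p ≠ ⊤) : MemLp (V N) p P :=
  (h p hp hp').1 N

theorem memLp_limit {V : ℕ → Ω → E} {W : Ω → E} (h : ConvergesInEveryLp V W P) {p : ENNReal}
    (hp : 1 ≤ p) (hp' : p ≠ ⊤) : MemLp W p P :=
  (h p hp hp').2.1

theorem congr {V V' : ℕ → Ω → E} {W W' : Ω → E} (h : ConvergesInEveryLp V W P)
    (hV : ∀ N ω, V' N ω = V N ω) (hW : ∀ ω, W' ω = W ω) : ConvergesInEveryLp V' W' P := by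
  have h1 : V' = V := funext fun N => funext (hV N)
  have h2 : W' = W := funext hW
  rwa [h1, h2]

theorem of_memLp {W : Ω → E} (h : ∀ p : ENNReal, 1 ≤ p → p ≠ ⊤ → MemLp W p P) :
    ConvergesInEveryLp (fun _ => W) W P :=
  fun p hp hp' => ⟨fun _ => h p hp hp', h p hp hp', by simp⟩

theorem of_tendsto [IsFiniteMeasure P] {c : ℕ → E} {a : E} (h : Tendsto c atTop (𝓝 a)) :
    ConvergesInEveryLp (fun N (_ : Ω) => c N) (fun _ => a) P := by
  refine fun p hp hp' => ⟨fun _ => memLp_const _, memLp_const _, ?_⟩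
  have hp0 : p ≠ 0 := (zero_lt_one.trans_le hp).ne'
  have h1 : Tendsto (fun N => ‖c N - a‖ₑ) atTop (𝓝 0) := by
    have := (tendsto_iff_edist_tendsto_0.1 h)
    simpa [edist_eq_enorm_sub] using this
  have h2 : ∀ N, eLpNorm ((fun _ : Ω => c N) - fun _ => a) p P
      = ‖c N - a‖ₑ * P Set.univ ^ (1 / p.toReal) := by
    intro N
    exact eLpNorm_const' (c N - a) hp0 hp'
  simp_rw [h2]
  have h3 := ENNReal.Tendsto.mul_const (b := P Set.univ ^ (1 / p.toReal)) h1
    (Or.inr (ENNReal.rpow_ne_top_of_nonneg (by positivity) (measure_ne_top _ _)))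
  simpa using h3

theorem const [IsFiniteMeasure P] (a : E) :
    ConvergesInEveryLp (fun _ (_ : Ω) => a) (fun _ => a) P :=
  of_tendsto tendsto_const_nhds

theorem add {V V' : ℕ → Ω → E} {W W' : Ω → E} (h : ConvergesInEveryLp V W P)
    (h' : ConvergesInEveryLp V' W' P) :
    ConvergesInEveryLp (fun N ω => V N ω + V' N ω) (fun ω => W ω + W' ω) P := by
  intro p hp hp'
  obtain ⟨a, b, c⟩ := h p hp hp'
  obtain ⟨a', b', c'⟩ := h' p hp hp'
  refine ⟨fun N => (a N).add (a' N), b.add b', ?_⟩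
  refine tendsto_of_tendsto_of_tendsto_of_le_of_le tendsto_const_nhds
    (by simpa using c.add c') (fun _ => zero_le) fun N => ?_
  have : ((fun ω => V N ω + V' N ω) - fun ω => W ω + W' ω) = (V N - W) + (V' N - W') := by
    ext ω; simp only [Pi.sub_apply, Pi.add_apply]; abel
  rw [this]
  exact eLpNorm_add_le ((a N).sub b).1 ((a' N).sub b').1 hp

theorem neg {V : ℕ → Ω → E} {W : Ω → E} (h : ConvergesInEveryLp V W P) :
    ConvergesInEveryLp (fun N ω => -V N ω) (fun ω => -W ω) P := by
  intro p hp hp'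
  obtain ⟨a, b, c⟩ := h p hp hp'
  refine ⟨fun N => (a N).neg, b.neg, ?_⟩
  convert c using 2 with N
  rw [← eLpNorm_neg]
  congr 1
  ext ω; simp only [Pi.sub_apply, Pi.neg_apply]; abel

theorem sub {V V' : ℕ → Ω → E} {W W' : Ω → E} (h : ConvergesInEveryLp V W P)
    (h' : ConvergesInEveryLp V' W' P) :
    ConvergesInEveryLp (fun N ω => V N ω - V' N ω) (fun ω => W ω - W' ω) P :=
  (h.add h'.neg).congr (fun _ _ => sub_eq_add_neg _ _) (fun _ => sub_eq_add_neg _ _)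

theorem sum [IsFiniteMeasure P] {ι : Type*} (s : Finset ι) {V : ι → ℕ → Ω → E} {W : ι → Ω → E}
    (h : ∀ i ∈ s, ConvergesInEveryLp (V i) (W i) P) :
    ConvergesInEveryLp (fun N ω => ∑ i ∈ s, V i N ω) (fun ω => ∑ i ∈ s, W i ω) P := by
  classical
  induction s using Finset.induction_on with
  | empty => simpa using const (P := P) (0 : E)
  | insert a s ha ih =>
    simp_rw [Finset.sum_insert ha]
    exact (h a (by simp)).add (ih fun i hi => h i (by simp [hi]))

/-- Convergence of a dominated sequence to zero. -/
theorem zero_of_norm_le {F : Type*} [NormedAddCommGroup F] {V : ℕ → Ω → E} {V' : ℕ → Ω → F}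
    (hV : ∀ N, AEStronglyMeasurable (V N) P) (h : ConvergesInEveryLp V' (fun _ => 0) P)
    (hle : ∀ N ω, ‖V N ω‖ ≤ ‖V' N ω‖) : ConvergesInEveryLp V (fun _ => 0) P := by
  intro p hp hp'
  obtain ⟨a, _, c⟩ := h p hp hp'
  refine ⟨fun N => (a N).mono (hV N) (.of_forall (hle N)), MemLp.zero, ?_⟩
  refine tendsto_of_tendsto_of_tendsto_of_le_of_le tendsto_const_nhds c
    (fun _ => zero_le) fun N => ?_
  exact eLpNorm_mono fun ω => by simpa using hle N ω

/-- Hölder's inequality, `L²ᵖ · L²ᵖ ⊆ Lᵖ`. No single exponent is stable under products; the class of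
all finite exponents is. -/
theorem mul {V V' : ℕ → Ω → ℝ} {W W' : Ω → ℝ} (h : ConvergesInEveryLp V W P)
    (h' : ConvergesInEveryLp V' W' P) :
    ConvergesInEveryLp (fun N ω => V N ω * V' N ω) (fun ω => W ω * W' ω) P := by
  intro p hp hp'
  have hH : ENNReal.HolderTriple (2 * p) (2 * p) p := ENNReal.holderTriple_two_mul
  have hq : 1 ≤ 2 * p := hp.trans (le_mul_of_one_le_left zero_le one_le_two)
  have hq' : 2 * p ≠ ⊤ := ENNReal.mul_ne_top (by simp) hp'
  obtain ⟨a, b, c⟩ := h _ hq hq'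
  obtain ⟨a', b', c'⟩ := h' _ hq hq'
  refine ⟨fun N => (a' N).mul' (a N), b'.mul' b, ?_⟩
  -- Expanding around the limit leaves only norms of differences and of `W`, `W'`, so no uniform
  -- bound on `V N` is needed.
  have hlim : Tendsto (fun N => eLpNorm (V N - W) (2 * p) P * eLpNorm (V' N - W') (2 * p) P
      + (eLpNorm (V N - W) (2 * p) P * eLpNorm W' (2 * p) P
        + eLpNorm W (2 * p) P * eLpNorm (V' N - W') (2 * p) P)) atTop (𝓝 0) := by
    have h1 := ENNReal.Tendsto.mul c (Or.inr ENNReal.zero_ne_top) c' (Or.inr ENNReal.zero_ne_top)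
    have h2 := ENNReal.Tendsto.mul_const (b := eLpNorm W' (2 * p) P) c
      (Or.inr b'.eLpNorm_ne_top)
    have h3 := ENNReal.Tendsto.const_mul (a := eLpNorm W (2 * p) P) c'
      (Or.inr b.eLpNorm_ne_top)
    simpa using h1.add (h2.add h3)
  refine tendsto_of_tendsto_of_tendsto_of_le_of_le tendsto_const_nhds hlim
    (fun _ => zero_le) fun N => ?_
  have : ((fun ω => V N ω * V' N ω) - fun ω => W ω * W' ω)
      = (V N - W) • (V' N - W') + ((V N - W) • W' + W • (V' N - W')) := by
    ext ω; simp only [Pi.sub_apply, Pi.add_apply, Pi.mul_apply, smul_eq_mul]; ring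
  rw [this]
  have m1 := ((a N).sub b).1
  have m2 := ((a' N).sub b').1
  refine (eLpNorm_add_le (m1.smul m2) ((m1.smul b'.1).add (b.1.smul m2)) hp).trans ?_
  refine add_le_add (eLpNorm_smul_le_mul_eLpNorm m2 m1) ?_
  refine (eLpNorm_add_le (m1.smul b'.1) (b.1.smul m2) hp).trans ?_
  exact add_le_add (eLpNorm_smul_le_mul_eLpNorm b'.1 m1) (eLpNorm_smul_le_mul_eLpNorm m2 b.1)

theorem eval {ι : Type*} [Fintype ι] {V : ℕ → Ω → EuclideanSpace ℝ ι} {W : Ω → EuclideanSpace ℝ ι}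
    (h : ConvergesInEveryLp V W P) (i : ι) :
    ConvergesInEveryLp (fun N ω => V N ω i) (fun ω => W ω i) P := by
  intro p hp hp'
  obtain ⟨a, b, c⟩ := h p hp hp'
  refine ⟨fun N => (a N).eval_piLp i, b.eval_piLp i, ?_⟩
  refine tendsto_of_tendsto_of_tendsto_of_le_of_le tendsto_const_nhds c
    (fun _ => zero_le) fun N => ?_
  exact eLpNorm_mono fun ω => by simpa using PiLp.norm_apply_le (V N ω - W ω) i

theorem of_eval [IsFiniteMeasure P] {ι : Type*} [Fintype ι] {V : ℕ → Ω → EuclideanSpace ℝ ι}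
    {W : Ω → EuclideanSpace ℝ ι}
    (h : ∀ i, ConvergesInEveryLp (fun N ω => V N ω i) (fun ω => W ω i) P) :
    ConvergesInEveryLp V W P := by
  intro p hp hp'
  have hV : ∀ N, MemLp (V N) p P := fun N => MemLp.of_eval_piLp fun i => (h i).memLp N hp hp'
  have hW : MemLp W p P := MemLp.of_eval_piLp fun i => (h i).memLp_limit hp hp'
  refine ⟨hV, hW, ?_⟩
  have hlim : Tendsto (fun N => ∑ i, eLpNorm ((fun ω => V N ω i) - fun ω => W ω i) p P) atTop
      (𝓝 0) := by
    simpa using tendsto_finsetSum Finset.univ fun i _ => (h i p hp hp').2.2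
  refine tendsto_of_tendsto_of_tendsto_of_le_of_le tendsto_const_nhds hlim
    (fun _ => zero_le) fun N => ?_
  let g : ι → Ω → ℝ := fun i ω => ‖((fun ω => V N ω i) - fun ω => W ω i) ω‖
  have hg : ∀ i, AEStronglyMeasurable (g i) P := fun i =>
    (((h i).memLp N hp hp').sub ((h i).memLp_limit hp hp')).1.norm
  calc eLpNorm (V N - W) p P ≤ eLpNorm (∑ i, g i) p P := by
        refine eLpNorm_mono_real fun ω => ?_
        rw [Finset.sum_apply]
        exact EuclideanSpace.norm_le_sum_norm (V N ω - W ω)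
    _ ≤ ∑ i, eLpNorm (g i) p P := eLpNorm_sum_le (fun i _ => hg i) hp
    _ = _ := Finset.sum_congr rfl fun i _ => eLpNorm_norm _

end ConvergesInEveryLp

/-! ### Inverse matrices and the Kalman gain: bounds, measurability, convergence. -/

open scoped Matrix in
/-- The entries of the inverse of a positive definite matrix are bounded, and the bound is not
affected by adding a positive semidefinite matrix. -/
theorem Matrix.PosDef.abs_inv_add_posSemidef_le {q : ℕ} {R G : Matrix (Fin q) (Fin q) ℝ}
    (hR : R.PosDef) (hG : G.PosSemidef) (i j : Fin q) :
    |(G + R)⁻¹ i j| ≤ (R⁻¹ i i + R⁻¹ j j) / 2 := by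
  have hS : (G + R).PosDef := hR.posSemidef_add hG
  have hRu : IsUnit R.det := (Matrix.isUnit_iff_isUnit_det _).1 hR.isUnit
  have hSu : IsUnit (G + R).det := (Matrix.isUnit_iff_isUnit_det _).1 hS.isUnit
  have hRt : R.transpose = R := hR.isHermitian.eq
  -- `x` is the `j`-th column of the inverse; dropping the nonnegative `G` part of its quadratic
  -- form gives `hxR`.
  let x : Fin q → ℝ := (G + R)⁻¹ *ᵥ Pi.single j 1
  have hx : ∀ k, x k = (G + R)⁻¹ k j := fun k => by simp [x]
  have hSx : (G + R) *ᵥ x = Pi.single j 1 := by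
    simp only [x, Matrix.mulVec_mulVec, Matrix.mul_nonsing_inv _ hSu, Matrix.one_mulVec]
  have hxR : x ⬝ᵥ R *ᵥ x ≤ x j := by
    have h1 : x ⬝ᵥ (G + R) *ᵥ x = x j := by rw [hSx]; simp
    have h2 : 0 ≤ x ⬝ᵥ G *ᵥ x := by simpa using hG.dotProduct_mulVec_nonneg x
    rw [Matrix.add_mulVec, dotProduct_add] at h1
    linarith
  -- The `R`-form at `x - t R⁻¹ eₖ` is nonnegative; its leading term is then bounded by `x j`.
  have key : ∀ (k : Fin q) (t : ℝ), 0 ≤ x j - 2 * t * x k + t ^ 2 * R⁻¹ k k := by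
    intro k t
    let y : Fin q → ℝ := R⁻¹ *ᵥ Pi.single k 1
    have hy : R *ᵥ y = Pi.single k 1 := by
      simp only [y, Matrix.mulVec_mulVec, Matrix.mul_nonsing_inv _ hRu, Matrix.one_mulVec]
    have h1 : x ⬝ᵥ R *ᵥ y = x k := by rw [hy]; simp
    have h2 : y ⬝ᵥ R *ᵥ x = x k := by
      rw [Matrix.dotProduct_mulVec, ← Matrix.mulVec_transpose, hRt, hy]; simp
    have h3 : y ⬝ᵥ R *ᵥ y = R⁻¹ k k := by rw [hy]; simp [y]
    have h4 : 0 ≤ (x - t • y) ⬝ᵥ R *ᵥ (x - t • y) := by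
      simpa using hR.posSemidef.dotProduct_mulVec_nonneg (x - t • y)
    have h5 : (x - t • y) ⬝ᵥ R *ᵥ (x - t • y)
        = x ⬝ᵥ R *ᵥ x - 2 * t * x k + t ^ 2 * R⁻¹ k k := by
      rw [Matrix.mulVec_sub, Matrix.mulVec_smul, sub_dotProduct, dotProduct_sub, dotProduct_sub,
        dotProduct_smul, dotProduct_smul, smul_dotProduct, smul_dotProduct, h1, h2, h3]
      simp only [smul_eq_mul]
      ring
    linarith
  -- `k1` gives `x j ≤ R⁻¹ j j`; the signs `t = ±1` at `i` give `2 |x i| ≤ x j + R⁻¹ i i`.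
  have k1 := key j 1
  have k2 := key i 1
  have k3 := key i (-1)
  rw [← hx, abs_le]
  constructor <;> linarith

theorem measurable_matrix_det {Ω : Type*} [MeasurableSpace Ω] {q : ℕ}
    {M : Ω → Matrix (Fin q) (Fin q) ℝ} (hM : ∀ i j, Measurable fun ω => M ω i j) :
    Measurable fun ω => (M ω).det := by
  simp only [Matrix.det_apply']
  fun_prop

/-- Cramer's rule: the entries are cofactors times the inverse determinant, and `0⁻¹ = 0` covers
singular matrices. -/
theorem measurable_matrix_inv {Ω : Type*} [MeasurableSpace Ω] {q : ℕ}
    {M : Ω → Matrix (Fin q) (Fin q) ℝ} (hM : ∀ i j, Measurable fun ω => M ω i j) (i j : Fin q) :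
    Measurable fun ω => (M ω)⁻¹ i j := by
  simp only [Matrix.inv_def, Ring.inverse_eq_inv', Matrix.smul_apply, Matrix.adjugate_apply,
    smul_eq_mul]
  refine (measurable_matrix_det hM).inv.mul (measurable_matrix_det fun k l => ?_)
  simp only [Matrix.updateRow_apply]
  split_ifs with h
  · exact measurable_const
  · exact hM k l

theorem measurable_matrix_mul {Ω : Type*} [MeasurableSpace Ω] {n q r : ℕ}
    {M : Ω → Matrix (Fin n) (Fin q) ℝ} {M' : Ω → Matrix (Fin q) (Fin r) ℝ}
    (hM : ∀ i j, Measurable fun ω => M ω i j) (hM' : ∀ i j, Measurable fun ω => M' ω i j)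
    (i : Fin n) (j : Fin r) : Measurable fun ω => (M ω * M' ω) i j := by
  simp only [Matrix.mul_apply]
  fun_prop

theorem measurable_kalmanGain {Ω : Type*} [MeasurableSpace Ω] {n q : ℕ}
    (H : Matrix (Fin q) (Fin n) ℝ) (R : Matrix (Fin q) (Fin q) ℝ)
    {Q : Ω → Matrix (Fin n) (Fin n) ℝ} (hQ : ∀ i j, Measurable fun ω => Q ω i j)
    (i : Fin n) (j : Fin q) : Measurable fun ω => kalmanGain H R (Q ω) i j := by
  have hc : ∀ {a b : ℕ} (M : Matrix (Fin a) (Fin b) ℝ) (i : Fin a) (j : Fin b),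
    Measurable fun _ : Ω => M i j := fun M i j => measurable_const
  refine measurable_matrix_mul (measurable_matrix_mul hQ (hc _))
    (measurable_matrix_inv fun k l => ?_) i j
  exact (measurable_matrix_mul (measurable_matrix_mul (hc H) hQ) (hc _) k l).add (hc R k l)

namespace ConvergesInEveryLp

variable {Ω : Type*} [MeasurableSpace Ω] {P : Measure Ω} [IsFiniteMeasure P]

theorem matrix_mul {n q r : ℕ} {M : ℕ → Ω → Matrix (Fin n) (Fin q) ℝ}
    {M' : ℕ → Ω → Matrix (Fin q) (Fin r) ℝ} {B : Ω → Matrix (Fin n) (Fin q) ℝ}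
    {B' : Ω → Matrix (Fin q) (Fin r) ℝ}
    (h : ∀ i j, ConvergesInEveryLp (fun N ω => M N ω i j) (fun ω => B ω i j) P)
    (h' : ∀ i j, ConvergesInEveryLp (fun N ω => M' N ω i j) (fun ω => B' ω i j) P)
    (i : Fin n) (j : Fin r) :
    ConvergesInEveryLp (fun N ω => (M N ω * M' N ω) i j) (fun ω => (B ω * B' ω) i j) P := by
  simp only [Matrix.mul_apply]
  exact sum _ fun k _ => (h i k).mul (h' k j)

/-- The resolvent identity `S⁻¹ - T⁻¹ = S⁻¹ (T - S) T⁻¹`, in which the random factor `S⁻¹` has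
entries bounded by a constant depending only on `R`, reduces the claim to the convergence of `G`. -/
theorem inv_add_posDef {q : ℕ} {R : Matrix (Fin q) (Fin q) ℝ} (hR : R.PosDef)
    {G : ℕ → Ω → Matrix (Fin q) (Fin q) ℝ} {B : Matrix (Fin q) (Fin q) ℝ}
    (hG : ∀ N ω, (G N ω).PosSemidef) (hB : B.PosSemidef)
    (hmeas : ∀ N i j, Measurable fun ω => G N ω i j)
    (h : ∀ i j, ConvergesInEveryLp (fun N ω => G N ω i j) (fun _ => B i j) P) (i j : Fin q) :
    ConvergesInEveryLp (fun N ω => (G N ω + R)⁻¹ i j) (fun _ => (B + R)⁻¹ i j) P := by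
  have hm : ∀ N i j, Measurable fun ω => (G N ω + R)⁻¹ i j := fun N i j =>
    measurable_matrix_inv (fun k l => (hmeas N k l).add measurable_const) i j
  have hinv : ∀ (M : Matrix (Fin q) (Fin q) ℝ), M.PosSemidef → IsUnit (M + R).det := fun M hM =>
    (Matrix.isUnit_iff_isUnit_det _).1 (hR.posSemidef_add hM).isUnit
  have hdiff : ∀ N ω, (G N ω + R)⁻¹ i j - (B + R)⁻¹ i j
      = ∑ l, (∑ k, (G N ω + R)⁻¹ i k * (B k l - G N ω k l)) * (B + R)⁻¹ l j := by
    intro N ω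
    have : (G N ω + R)⁻¹ - (B + R)⁻¹ = (G N ω + R)⁻¹ * (B - G N ω) * (B + R)⁻¹ := by
      have e : B - G N ω = (B + R) - (G N ω + R) := by abel
      rw [e, Matrix.mul_sub, Matrix.sub_mul, Matrix.mul_assoc,
        Matrix.mul_nonsing_inv _ (hinv B hB), Matrix.nonsing_inv_mul _ (hinv _ (hG N ω)),
        Matrix.mul_one, Matrix.one_mul]
    have h2 := congrFun (congrFun this i) j
    simpa [Matrix.mul_apply] using h2
  have hzero : ConvergesInEveryLp (fun N ω => (G N ω + R)⁻¹ i j - (B + R)⁻¹ i j)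
      (fun _ => 0) P := by
    have hs : ConvergesInEveryLp
        (fun N ω => ∑ l, (∑ k, (G N ω + R)⁻¹ i k * (B k l - G N ω k l)) * (B + R)⁻¹ l j)
        (fun _ => ∑ l, (∑ k : Fin q, (0 : ℝ)) * (B + R)⁻¹ l j) P := by
      refine sum _ fun l _ => (sum _ fun k _ => ?_).mul (const _)
      have hd : ConvergesInEveryLp
          (fun N ω => (R⁻¹ i i + R⁻¹ k k) / 2 * (B k l - G N ω k l)) (fun _ => 0) P :=
        ((const _).mul ((const _).sub (h k l))).congr (fun _ _ => rfl) (by simp)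
      refine zero_of_norm_le (fun N => ?_) hd fun N ω => ?_
      · exact ((hm N i k).mul (measurable_const.sub (hmeas N k l))).aestronglyMeasurable
      · rw [norm_mul, norm_mul]
        refine mul_le_mul_of_nonneg_right ?_ (norm_nonneg _)
        exact (hR.abs_inv_add_posSemidef_le (hG N ω) i k).trans (le_abs_self _)
    exact hs.congr hdiff (by simp)
  exact (hzero.add (const ((B + R)⁻¹ i j))).congr (by simp) (by simp)

theorem kalmanGain {n q : ℕ} (H : Matrix (Fin q) (Fin n) ℝ) {R : Matrix (Fin q) (Fin q) ℝ}
    (hR : R.PosDef) {G : ℕ → Ω → Matrix (Fin n) (Fin n) ℝ} {B : Matrix (Fin n) (Fin n) ℝ}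
    (hG : ∀ N ω, (G N ω).PosSemidef) (hB : B.PosSemidef)
    (hmeas : ∀ N i j, Measurable fun ω => G N ω i j)
    (h : ∀ i j, ConvergesInEveryLp (fun N ω => G N ω i j) (fun _ => B i j) P)
    (i : Fin n) (j : Fin q) :
    ConvergesInEveryLp (fun N ω => _root_.kalmanGain H R (G N ω) i j)
      (fun _ => _root_.kalmanGain H R B i j) P := by
  have hc : ∀ {a b : ℕ} (M : Matrix (Fin a) (Fin b) ℝ) (i : Fin a) (j : Fin b),
    Measurable fun _ : Ω => M i j := fun M i j => measurable_const
  refine matrix_mul (B := fun _ => B * H.transpose) (B' := fun _ => (H * B * H.transpose + R)⁻¹)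
    (matrix_mul (B := fun _ => B) (B' := fun _ => H.transpose) h fun _ _ => const _)
    (inv_add_posDef hR (fun N ω => ?_) ?_ (fun N => ?_)
      (matrix_mul (B := fun _ => H * B) (B' := fun _ => H.transpose)
        (matrix_mul (B := fun _ => H) (B' := fun _ => B) (fun _ _ => const _) h)
        fun _ _ => const _)) i j
  · simpa using (hG N ω).mul_mul_conjTranspose_same H
  · simpa using hB.mul_mul_conjTranspose_same H
  · exact measurable_matrix_mul (measurable_matrix_mul (hc H) (hmeas N)) (hc _)

end ConvergesInEveryLp

/-! ### Sample covariance and the law of large numbers. -/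

/-- Expresses the covariance through averages, to which the law of large numbers applies. For a
single member (`N = 0`) both sides vanish since `0⁻¹ = 0`. -/
theorem sampleCov_apply {n N : ℕ} (x : Fin (N + 1) → EuclideanSpace ℝ (Fin n)) (i j : Fin n) :
    sampleCov x i j = (N : ℝ)⁻¹ * (N + 1) * (((N : ℝ) + 1)⁻¹ * ∑ k, x k i * x k j
      - (((N : ℝ) + 1)⁻¹ * ∑ k, x k i) * (((N : ℝ) + 1)⁻¹ * ∑ k, x k j)) := by
  have hm : ∀ l, sampleMean x l = ((N : ℝ) + 1)⁻¹ * ∑ k, x k l := fun l => by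
    simp [sampleMean]
  have hN : (N : ℝ) + 1 ≠ 0 := by positivity
  have h1 : ∑ k, (x k i - sampleMean x i) * (x k j - sampleMean x j)
      = ∑ k, x k i * x k j - (N + 1) * sampleMean x i * sampleMean x j := by
    have hs : ∀ l, ∑ k, x k l = (N + 1) * sampleMean x l := fun l => by
      rw [hm, mul_inv_cancel_left₀ hN]
    simp only [sub_mul, mul_sub, Finset.sum_sub_distrib, ← Finset.mul_sum, ← Finset.sum_mul, hs]
    simp
  simp only [sampleCov, Matrix.smul_apply, Matrix.sum_apply, Matrix.vecMulVec_apply, smul_eq_mul,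
    WithLp.ofLp_sub, Pi.sub_apply, h1, ← hm]
  push_cast
  field_simp
  ring

theorem sampleCov_posSemidef {n N : ℕ} (x : Fin (N + 1) → EuclideanSpace ℝ (Fin n)) :
    (sampleCov x).PosSemidef := by
  refine (Matrix.posSemidef_sum _ fun k _ => ?_).smul (by simp)
  simpa using Matrix.posSemidef_vecMulVec_self_star (x k - sampleMean x).ofLp

/-- The quadratic form at `x` is the variance of `∑ xᵢ Vᵢ`. -/
theorem covMat_posSemidef {Ω : Type*} [MeasurableSpace Ω] {P : Measure Ω} [IsFiniteMeasure P]
    {n : ℕ} {V : Ω → EuclideanSpace ℝ (Fin n)} (hV : MemLp V 2 P) : (covMat P V).PosSemidef := by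
  refine Matrix.PosSemidef.of_dotProduct_mulVec_nonneg ?_ fun x => ?_
  · ext i j
    simp [covMat, covariance_comm]
  · have h : ∀ i ∈ Finset.univ, MemLp (fun ω => x i * V ω i) 2 P := fun i _ =>
      (hV.eval_piLp i).const_mul (x i)
    have h2 := variance_nonneg (∑ i, fun ω => x i * V ω i) P
    rw [variance_sum' h] at h2
    refine h2.trans_eq ?_
    simp only [covariance_const_mul_left, covariance_const_mul_right]
    simp only [dotProduct, Matrix.mulVec, covMat, Matrix.of_apply, Finset.mul_sum, star_trivial]
    exact Finset.sum_congr rfl fun i _ => Finset.sum_congr rfl fun j _ => by ring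

namespace ConvergesInEveryLp

variable {Ω : Type*} [MeasurableSpace Ω] {P : Measure Ω} [IsProbabilityMeasure P]

/-- Law of large numbers for the averages of a triangular array that is close to an independent,
identically distributed sequence. -/
theorem average {V : (N : ℕ) → Fin (N + 1) → Ω → ℝ} {W : ℕ → Ω → ℝ}
    (h : ConvergesInEveryLp (fun N => V N 0) (W 0) P)
    (hident : ∀ N (k : Fin (N + 1)),
      IdentDistrib (fun ω => (V N k ω, W k ω)) (fun ω => (V N 0 ω, W 0 ω)) P P)
    (hindep : Pairwise fun k l => IndepFun (W k) (W l) P) :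
    ConvergesInEveryLp (fun N ω => ((N : ℝ) + 1)⁻¹ * ∑ k, V N k ω) (fun _ => ∫ ω, W 0 ω ∂P) P := by
  intro p hp hp'
  have hV : ∀ N k, MemLp (V N k) p P := fun N k =>
    ((hident N k).comp measurable_fst).symm.memLp_snd (h.memLp N hp hp')
  -- `W k` is paired with the last member of the ensemble of size `k + 1`, so `hident` reaches every
  -- `k`.
  have hWid : ∀ k, IdentDistrib (W k) (W 0) P P := fun k => by
    simpa using! (hident k (Fin.last k)).comp measurable_snd
  have hW : ∀ k, MemLp (W k) p P := fun k => (hWid k).symm.memLp_snd (h.memLp_limit hp hp')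
  have hVa : ∀ N : ℕ, MemLp (fun ω => ((N : ℝ) + 1)⁻¹ * ∑ k, V N k ω) p P := fun N =>
    (memLp_finsetSum _ fun k _ => hV N k).const_mul _
  refine ⟨hVa, memLp_const _, ?_⟩
  have hlim1 := (h p hp hp').2.2
  have hlim2 := (tendsto_add_atTop_iff_nat 1).2
    (strong_law_Lp hp hp' W (h.memLp_limit hp hp') hindep hWid)
  have hlim := hlim1.add hlim2
  rw [add_zero] at hlim
  refine tendsto_of_tendsto_of_tendsto_of_le_of_le tendsto_const_nhds hlim
    (fun _ => zero_le) fun N => ?_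
  -- The error is the average of `V N k - W k`, plus the error of the law of large numbers for `W`.
  have hsplit : ((fun ω => ((N : ℝ) + 1)⁻¹ * ∑ k, V N k ω) - fun _ => ∫ ω, W 0 ω ∂P)
      = (((N : ℝ) + 1)⁻¹ • ∑ k : Fin (N + 1), (V N k - W k))
        + fun ω => (((N + 1 : ℕ) : ℝ)⁻¹ • (∑ i ∈ Finset.range (N + 1), W i ω) - ∫ ω, W 0 ω ∂P) := by
    ext ω
    simp only [Pi.sub_apply, Pi.add_apply, Pi.smul_apply, Finset.sum_apply, smul_eq_mul,
      Finset.sum_sub_distrib, Finset.sum_range]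
    push_cast
    ring
  have hdm : ∀ k : Fin (N + 1), MemLp (V N k - W k) p P := fun k => (hV N k).sub (hW k)
  have hm2 : AEStronglyMeasurable
      (fun ω => (((N + 1 : ℕ) : ℝ)⁻¹ • (∑ i ∈ Finset.range (N + 1), W i ω) - ∫ ω, W 0 ω ∂P)) P :=
    (((memLp_finsetSum (Finset.range (N + 1)) fun k _ => hW k).const_smul
      (((N + 1 : ℕ) : ℝ)⁻¹)).sub (memLp_const (∫ ω, W 0 ω ∂P))).1
  rw [hsplit]
  refine (eLpNorm_add_le ((memLp_finsetSum' _ fun k _ => hdm k).const_smul _).1 hm2 hp).trans ?_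
  refine add_le_add ?_ le_rfl
  rw [eLpNorm_const_smul]
  -- All the differences have the law of the first one, hence the same norm.
  have hsum : eLpNorm (∑ k : Fin (N + 1), (V N k - W k)) p P
      ≤ (N + 1 : ℕ) * eLpNorm (V N 0 - W 0) p P := by
    refine (eLpNorm_sum_le (fun k _ => (hdm k).1) hp).trans ?_
    have : ∀ k ∈ Finset.univ, eLpNorm (V N k - W (k : Fin (N + 1))) p P
        = eLpNorm (V N 0 - W 0) p P := fun k _ =>
      ((hident N k).comp (measurable_fst.sub measurable_snd)).eLpNorm_eq p
    rw [Finset.sum_congr rfl this]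
    simp
  refine (mul_le_mul_right hsum _).trans_eq ?_
  rw [← mul_assoc]
  have : ‖((N : ℝ) + 1)⁻¹‖ₑ * ((N + 1 : ℕ) : ENNReal) = 1 := by
    rw [enorm_inv (by positivity)]
    have : ‖(N : ℝ) + 1‖ₑ = ((N + 1 : ℕ) : ENNReal) := by
      rw [← Nat.cast_succ, Real.enorm_natCast]
    rw [this]
    exact ENNReal.inv_mul_cancel (by simp) (by simp)
  rw [this, one_mul]

/-- Convergence of the sample covariance to the exact covariance of the limit. -/
theorem sampleCov {n : ℕ} {V : (N : ℕ) → Fin (N + 1) → Ω → EuclideanSpace ℝ (Fin n)}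
    {W : ℕ → Ω → EuclideanSpace ℝ (Fin n)}
    (h : ConvergesInEveryLp (fun N => V N 0) (W 0) P)
    (hident : ∀ N (k : Fin (N + 1)),
      IdentDistrib (fun ω => (V N k ω, W k ω)) (fun ω => (V N 0 ω, W 0 ω)) P P)
    (hindep : Pairwise fun k l => IndepFun (W k) (W l) P) (i j : Fin n) :
    ConvergesInEveryLp (fun N ω => _root_.sampleCov (fun k => V N k ω) i j)
      (fun _ => covMat P (W 0) i j) P := by
  have hi : ∀ l : Fin n, Measurable fun x : EuclideanSpace ℝ (Fin n) => x l := fun l => by fun_prop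
  -- Used for coordinates and for products of two coordinates, that is, for first and second
  -- moments.
  have hf : ∀ f : EuclideanSpace ℝ (Fin n) → ℝ, Measurable f →
      ConvergesInEveryLp (fun N ω => f (V N 0 ω)) (fun ω => f (W 0 ω)) P →
      ConvergesInEveryLp (fun N ω => ((N : ℝ) + 1)⁻¹ * ∑ k, f (V N k ω))
        (fun _ => ∫ ω, f (W 0 ω) ∂P) P := fun f hfm hfc =>
    average (V := fun N k ω => f (V N k ω)) (W := fun k ω => f (W k ω)) hfc
      (fun N k => (hident N k).comp
        (u := fun z : EuclideanSpace ℝ (Fin n) × EuclideanSpace ℝ (Fin n) => (f z.1, f z.2))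
        ((hfm.comp measurable_fst).prodMk (hfm.comp measurable_snd)))
      fun k l hkl => (hindep hkl).comp hfm hfm
  have hratio : Tendsto (fun N : ℕ => (N : ℝ)⁻¹ * (N + 1)) atTop (𝓝 1) := by
    have h1 : Tendsto (fun N : ℕ => 1 + (N : ℝ)⁻¹) atTop (𝓝 (1 + 0)) :=
      tendsto_const_nhds.add tendsto_inv_atTop_nhds_zero_nat
    rw [add_zero] at h1
    refine h1.congr' ?_
    filter_upwards [eventually_gt_atTop 0] with N hN
    have : (N : ℝ) ≠ 0 := by positivity
    field_simp
  refine ((of_tendsto hratio).mul (((hf (fun x => x i * x j) ((hi i).mul (hi j))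
    ((h.eval i).mul (h.eval j))).sub
      ((hf _ (hi i) (h.eval i)).mul (hf _ (hi j) (h.eval j)))))).congr
    (fun N ω => sampleCov_apply _ i j) fun ω => ?_
  have h2 := h.memLp_limit (p := 2) one_le_two (by simp)
  simp only [covMat, Matrix.of_apply]
  rw [covariance_eq_sub (h2.eval_piLp i) (h2.eval_piLp j), one_mul]
  rfl

end ConvergesInEveryLp

/-! ### Measurability and permutation symmetry of the filter. -/

theorem measurable_euclideanSpace_iff {Z : Type*} {_ : MeasurableSpace Z} {n : ℕ}
    {f : Z → EuclideanSpace ℝ (Fin n)} : Measurable f ↔ ∀ i, Measurable fun z => f z i := by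
  refine ⟨fun h i => by fun_prop, fun h => ?_⟩
  exact (WithLp.measurable_toLp 2 _).comp (measurable_pi_lambda (fun z i => f z i) h)

theorem measurable_matVec {Z : Type*} {_ : MeasurableSpace Z} {n q : ℕ}
    {M : Z → Matrix (Fin q) (Fin n) ℝ} {v : Z → EuclideanSpace ℝ (Fin n)}
    (hM : ∀ i j, Measurable fun z => M z i j) (hv : Measurable v) :
    Measurable fun z => matVec (M z) (v z) :=
  measurable_euclideanSpace_iff.2 fun i => Finset.measurable_fun_sum Finset.univ fun j _ =>
    (hM i j).mul (measurable_euclideanSpace_iff.1 hv j)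

theorem measurable_analysisUpdate {Z : Type*} {_ : MeasurableSpace Z} {n q : ℕ}
    (H : Matrix (Fin q) (Fin n) ℝ) {K : Z → Matrix (Fin n) (Fin q) ℝ}
    {x : Z → EuclideanSpace ℝ (Fin n)} {y : Z → EuclideanSpace ℝ (Fin q)}
    (hK : ∀ i j, Measurable fun z => K z i j) (hx : Measurable x) (hy : Measurable y) :
    Measurable fun z => analysisUpdate H (K z) (x z) (y z) :=
  hx.add (measurable_matVec hK (hy.sub (measurable_matVec (fun _ _ => measurable_const) hx)))

theorem measurable_sampleCov {Z : Type*} {_ : MeasurableSpace Z} {n N : ℕ}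
    {x : Fin N → Z → EuclideanSpace ℝ (Fin n)} (hx : ∀ k, Measurable (x k)) (i j : Fin n) :
    Measurable fun z => sampleCov (fun k => x k z) i j := by
  have hmean : Measurable fun z => sampleMean fun k => x k z :=
    (Finset.measurable_fun_sum Finset.univ fun k _ => hx k).const_smul ((N : ℝ)⁻¹)
  have hm : ∀ k l, Measurable fun z => (x k z - sampleMean (fun k => x k z)) l := fun k =>
    measurable_euclideanSpace_iff.1 ((hx k).sub hmean)
  simp only [sampleCov, Matrix.smul_apply, Matrix.sum_apply, Matrix.vecMulVec_apply, smul_eq_mul]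
  exact (Finset.measurable_fun_sum _ fun k _ => (hm k i).mul (hm k j)).const_mul _

theorem sampleCov_comp_perm {n N : ℕ} (x : Fin N → EuclideanSpace ℝ (Fin n))
    (π : Equiv.Perm (Fin N)) : sampleCov (fun k => x (π k)) = sampleCov x := by
  have hm : sampleMean (fun k => x (π k)) = sampleMean x := by
    simp only [sampleMean, Equiv.sum_comp π x]
  simp only [sampleCov, hm]
  congr 1
  exact Equiv.sum_comp π fun k =>
    Matrix.vecMulVec (x k - sampleMean x).ofLp (x k - sampleMean x).ofLp

namespace AssimilationProblem

variable {n : ℕ} (S : AssimilationProblem n)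

theorem measurable_model (m : ℕ) : Measurable (S.model m) :=
  (measurable_matVec (M := fun _ => S.A m) (fun _ _ => measurable_const) measurable_id).add_const
    (S.b m)

theorem measurable_enkfAnalysis {Z : Type*} {_ : MeasurableSpace Z} {N : ℕ}
    {x₀ : Fin N → Z → EuclideanSpace ℝ (Fin n)}
    {D : (m : ℕ) → Fin N → Z → EuclideanSpace ℝ (Fin (S.obsDim m))}
    (hx₀ : ∀ k, Measurable (x₀ k)) (hD : ∀ m k, Measurable (D m k)) (m : ℕ) (k : Fin N) :
    Measurable fun z => S.enkfAnalysis (fun j => x₀ j z) (fun l j => D l j z) m k := by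
  induction m generalizing k with
  | zero => exact hx₀ k
  | succ m ih =>
    have hx := fun k => (S.measurable_model m).comp (ih k)
    exact measurable_analysisUpdate (S.H m)
      (measurable_kalmanGain _ _ (measurable_sampleCov hx)) (hx k) (hD m k)

/-- Members interact only through the sample covariance, which is a symmetric function of the
ensemble. -/
theorem enkfAnalysis_comp_perm {N : ℕ} (x₀ : Fin N → EuclideanSpace ℝ (Fin n))
    (D : (m : ℕ) → Fin N → EuclideanSpace ℝ (Fin (S.obsDim m))) (π : Equiv.Perm (Fin N))
    (m : ℕ) (k : Fin N) :
    S.enkfAnalysis (fun j => x₀ (π j)) (fun l j => D l (π j)) m k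
      = S.enkfAnalysis x₀ D m (π k) := by
  induction m generalizing k with
  | zero => rfl
  | succ m ih =>
    simp only [enkfAnalysis, ih]
    rw [sampleCov_comp_perm (fun k => S.model m (S.enkfAnalysis x₀ D m k)) π]

/-- The analysis of a single member, run with a prescribed sequence of gains. -/
noncomputable def gainAnalysis (K : (m : ℕ) → Matrix (Fin n) (Fin (S.obsDim m)) ℝ)
    (x : EuclideanSpace ℝ (Fin n)) (y : (m : ℕ) → EuclideanSpace ℝ (Fin (S.obsDim m))) :
    ℕ → EuclideanSpace ℝ (Fin n)
  | 0 => x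
  | m + 1 => analysisUpdate (S.H m) (K m) (S.model m (gainAnalysis K x y m)) (y m)

theorem measurable_gainAnalysis {Z : Type*} {_ : MeasurableSpace Z}
    (K : (m : ℕ) → Matrix (Fin n) (Fin (S.obsDim m)) ℝ) {x : Z → EuclideanSpace ℝ (Fin n)}
    {y : (m : ℕ) → Z → EuclideanSpace ℝ (Fin (S.obsDim m))} (hx : Measurable x)
    (hy : ∀ m, Measurable (y m)) (m : ℕ) :
    Measurable fun z => S.gainAnalysis K (x z) (fun l => y l z) m := by
  induction m with
  | zero => exact hx
  | succ m ih =>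
    exact measurable_analysisUpdate (S.H m) (fun _ _ => measurable_const)
      ((S.measurable_model m).comp ih) (hy m)

variable {Ω : Type*} [MeasurableSpace Ω] (P : Measure Ω)

/-- The reference gains are deterministic, so each member is the same fixed function of its own
inputs alone. -/
theorem refAnalysis_eq_gainAnalysis (U₀ : ℕ → Ω → EuclideanSpace ℝ (Fin n))
    (D : (m : ℕ) → ℕ → Ω → EuclideanSpace ℝ (Fin (S.obsDim m))) (m k : ℕ) (ω : Ω) :
    S.refAnalysis P U₀ D m k ω = S.gainAnalysis
      (fun l => kalmanGain (S.H l) (S.R l) (covMat P (S.refForecast P U₀ D (l + 1) 0)))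
      (U₀ k ω) (fun l => D l k ω) m := by
  induction m with
  | zero => rfl
  | succ m ih => rw [gainAnalysis, ← ih]; rfl

/-! ### Joint law of the inputs, exchangeability, and independence of the reference members. -/

/-- The type of the input with index `i`: an initial member, or a perturbed data vector. -/
abbrev Input (N : ℕ) (i : Fin N ⊕ ℕ × Fin N) : Type :=
  EuclideanSpace ℝ (Fin (i.elim (fun _ => n) fun lk => S.obsDim lk.1))

/-- The initial members and the data vectors of an ensemble with the members `σ 0, σ 1, …`. -/
def inputs (U₀ : ℕ → Ω → EuclideanSpace ℝ (Fin n))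
    (D : (m : ℕ) → ℕ → Ω → EuclideanSpace ℝ (Fin (S.obsDim m))) {N : ℕ} (σ : Fin N → ℕ) :
    (i : Fin N ⊕ ℕ × Fin N) → Ω → S.Input N i
  | .inl k => U₀ (σ k)
  | .inr lk => D lk.1 (σ lk.2)

/-- The `σ`-algebra generated by the initial member with index `k`, or by the data vector
with index `(m, k)`. -/
abbrev inputSpace (U₀ : ℕ → Ω → EuclideanSpace ℝ (Fin n))
    (D : (m : ℕ) → ℕ → Ω → EuclideanSpace ℝ (Fin (S.obsDim m))) (i : ℕ ⊕ ℕ × ℕ) :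
    MeasurableSpace Ω :=
  Sum.elim (fun k => MeasurableSpace.comap (U₀ k) inferInstance)
    (fun mk : ℕ × ℕ => MeasurableSpace.comap (D mk.1 mk.2) inferInstance) i

section Independent

variable {S P} {U₀ : ℕ → Ω → EuclideanSpace ℝ (Fin n)}
  {D : (m : ℕ) → ℕ → Ω → EuclideanSpace ℝ (Fin (S.obsDim m))}

theorem iIndepFun_inputs (h_indep : iIndep (S.inputSpace U₀ D) P) {N : ℕ} {σ : Fin N → ℕ}
    (hσ : Function.Injective σ) : iIndepFun (S.inputs U₀ D σ) P := by
  have hg : Function.Injective (Sum.map σ (Prod.map id σ) : Fin N ⊕ ℕ × Fin N → ℕ ⊕ ℕ × ℕ) :=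
    hσ.sumMap (Function.injective_id.prodMap hσ)
  have := h_indep.precomp hg
  rw [iIndepFun_iff_iIndep]
  convert! this using 1
  funext i
  rcases i with k | ⟨l, k⟩ <;> rfl

theorem measurable_inputs (hU₀_meas : ∀ k, Measurable (U₀ k)) (hD_meas : ∀ m k, Measurable (D m k))
    {N : ℕ} (σ : Fin N → ℕ) (i : Fin N ⊕ ℕ × Fin N) : Measurable (S.inputs U₀ D σ i) := by
  rcases i with k | ⟨l, k⟩
  exacts [hU₀_meas _, hD_meas _ _]

/-- Independence makes both joint laws products of marginals, and the marginals do not depend on the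
member. -/
theorem identDistrib_inputs [IsProbabilityMeasure P] (h_indep : iIndep (S.inputSpace U₀ D) P)
    (hU₀_meas : ∀ k, Measurable (U₀ k)) (hD_meas : ∀ m k, Measurable (D m k))
    (hU₀ : ∀ k l, P.map (U₀ k) = P.map (U₀ l)) (hD : ∀ m k l, P.map (D m k) = P.map (D m l))
    {N : ℕ} {σ τ : Fin N → ℕ} (hσ : Function.Injective σ) (hτ : Function.Injective τ) :
    IdentDistrib (fun ω i => S.inputs U₀ D σ i ω) (fun ω i => S.inputs U₀ D τ i ω) P P where
  aemeasurable_fst := (measurable_pi_lambda _ (measurable_inputs hU₀_meas hD_meas σ)).aemeasurable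
  aemeasurable_snd := (measurable_pi_lambda _ (measurable_inputs hU₀_meas hD_meas τ)).aemeasurable
  map_eq := by
    rw [(iIndepFun_inputs h_indep hσ).map_fun_eq_infinitePi_map
        (measurable_inputs hU₀_meas hD_meas σ),
      (iIndepFun_inputs h_indep hτ).map_fun_eq_infinitePi_map
        (measurable_inputs hU₀_meas hD_meas τ)]
    congr 1
    funext i
    rcases i with k | ⟨l, k⟩
    exacts [hU₀ _ _, hD _ _ _]

/-- The map `f` from inputs to pairs is equivariant, so permuting the pairs amounts to permuting the
inputs, which preserves their law. -/
theorem exchangeable_analysis [IsProbabilityMeasure P] (h_indep : iIndep (S.inputSpace U₀ D) P)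
    (hU₀_meas : ∀ k, Measurable (U₀ k)) (hD_meas : ∀ m k, Measurable (D m k))
    (hU₀ : ∀ k l, P.map (U₀ k) = P.map (U₀ l)) (hD : ∀ m k l, P.map (D m k) = P.map (D m l))
    (N m : ℕ) :
    Exchangeable (fun (k : Fin N) ω =>
      (S.randomAnalysis U₀ D N m k ω, S.refAnalysis P U₀ D m k ω)) P := by
  intro π
  let K := fun l => kalmanGain (S.H l) (S.R l) (covMat P (S.refForecast P U₀ D (l + 1) 0))
  let f : ((i : Fin N ⊕ ℕ × Fin N) → S.Input N i) → Fin N →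
      EuclideanSpace ℝ (Fin n) × EuclideanSpace ℝ (Fin n) := fun z k =>
    (S.enkfAnalysis (fun j => z (.inl j)) (fun l j => z (.inr (l, j))) m k,
      S.gainAnalysis K (z (.inl k)) (fun l => z (.inr (l, k))) m)
  have hz : ∀ i, Measurable fun z : (i : Fin N ⊕ ℕ × Fin N) → S.Input N i => z i :=
    fun i => measurable_pi_apply i
  have hf : Measurable f := measurable_pi_lambda _ fun k =>
    (S.measurable_enkfAnalysis (fun k => hz (.inl k)) (fun l k => hz (.inr (l, k))) m k).prodMk
      (S.measurable_gainAnalysis K (hz (.inl k)) (fun l => hz (.inr (l, k))) m)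
  have h := (identDistrib_inputs h_indep hU₀_meas hD_meas hU₀ hD
    (Fin.val_injective.comp π.injective) (Fin.val_injective (n := N))).comp hf
  convert! h using 1
  · funext ω k
    refine Prod.ext ?_ (S.refAnalysis_eq_gainAnalysis P U₀ D m (π k) ω)
    exact (S.enkfAnalysis_comp_perm (fun j : Fin N => U₀ j ω) (fun l (j : Fin N) => D l j ω)
      π m k).symm
  · funext ω k
    exact Prod.ext rfl (S.refAnalysis_eq_gainAnalysis P U₀ D m k ω)

theorem indepFun_refAnalysis (h_indep : iIndep (S.inputSpace U₀ D) P)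
    (hU₀_meas : ∀ k, Measurable (U₀ k)) (hD_meas : ∀ m k, Measurable (D m k)) (m : ℕ) {k l : ℕ}
    (hkl : k ≠ l) : IndepFun (S.refAnalysis P U₀ D m k) (S.refAnalysis P U₀ D m l) P := by
  -- `T k` collects the inputs of member `k`: its initial state and its data from all cycles. These
  -- index sets are disjoint for distinct members.
  let T : ℕ → Set (ℕ ⊕ ℕ × ℕ) := fun k => {i | i.elim id Prod.snd = k}
  have hle : ∀ i, S.inputSpace U₀ D i ≤ ‹MeasurableSpace Ω› := by
    rintro (k | ⟨l, k⟩)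
    exacts [(hU₀_meas k).comap_le, (hD_meas l k).comap_le]
  have hT : Disjoint (T k) (T l) :=
    Set.disjoint_left.2 fun i (hi : _ = k) (hi' : _ = l) => hkl (hi.symm.trans hi')
  have hmeas : ∀ k, MeasurableSpace.comap (S.refAnalysis P U₀ D m k) inferInstance
      ≤ ⨆ i ∈ T k, S.inputSpace U₀ D i := by
    intro k
    refine Measurable.comap_le ?_
    rw [show S.refAnalysis P U₀ D m k = _ from
      funext (S.refAnalysis_eq_gainAnalysis P U₀ D m k)]
    refine S.measurable_gainAnalysis _ (Measurable.of_comap_le ?_)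
      (fun l => Measurable.of_comap_le ?_) m
    · exact le_iSup₂_of_le (f := fun i (_ : i ∈ T k) => S.inputSpace U₀ D i) (.inl k) rfl le_rfl
    · exact le_iSup₂_of_le (f := fun i (_ : i ∈ T k) => S.inputSpace U₀ D i)
        (.inr (l, k)) rfl le_rfl
  rw [IndepFun_iff_Indep]
  exact indep_of_indep_of_le_left (indep_of_indep_of_le_right
    (indep_iSup_of_disjoint hle h_indep hT) (hmeas l)) (hmeas k)

end Independent

end AssimilationProblem

/-! ### Induction over the analysis cycles. -/

namespace ConvergesInEveryLp

variable {Ω : Type*} [MeasurableSpace Ω] {P : Measure Ω} [IsFiniteMeasure P]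

theorem matVec {n q : ℕ} {M : ℕ → Ω → Matrix (Fin q) (Fin n) ℝ} {B : Ω → Matrix (Fin q) (Fin n) ℝ}
    {V : ℕ → Ω → EuclideanSpace ℝ (Fin n)} {W : Ω → EuclideanSpace ℝ (Fin n)}
    (hM : ∀ i j, ConvergesInEveryLp (fun N ω => M N ω i j) (fun ω => B ω i j) P)
    (hV : ConvergesInEveryLp V W P) :
    ConvergesInEveryLp (fun N ω => _root_.matVec (M N ω) (V N ω))
      (fun ω => _root_.matVec (B ω) (W ω)) P :=
  of_eval fun i => sum Finset.univ fun j _ => (hM i j).mul (hV.eval j)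

theorem model {n : ℕ} (S : AssimilationProblem n) (m : ℕ) {V : ℕ → Ω → EuclideanSpace ℝ (Fin n)}
    {W : Ω → EuclideanSpace ℝ (Fin n)} (hV : ConvergesInEveryLp V W P) :
    ConvergesInEveryLp (fun N ω => S.model m (V N ω)) (fun ω => S.model m (W ω)) P :=
  (matVec (B := fun _ => S.A m) (fun _ _ => const _) hV).add (const _)

end ConvergesInEveryLp

theorem ProbabilityTheory.HasLaw.memLp_of_isGaussian {Ω E : Type*} [MeasurableSpace Ω]
    {P : Measure Ω} [NormedAddCommGroup E] [NormedSpace ℝ E] [MeasurableSpace E] [BorelSpace E]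
    [SecondCountableTopology E] [CompleteSpace E] {X : Ω → E} {μ : Measure E} [IsGaussian μ]
    (hX : HasLaw X μ P) {p : ENNReal} (hp : p ≠ ⊤) : MemLp X p P := by
  have h := IsGaussian.memLp_id μ p hp
  rw [← hX.map_eq] at h
  exact h.comp_of_map hX.aemeasurable

namespace Exchangeable

variable {Ω E F : Type*} [MeasurableSpace Ω] [MeasurableSpace E] [MeasurableSpace F]
  {P : Measure Ω}

theorem comp {N : ℕ} {Z : Fin N → Ω → E} (h : Exchangeable Z P) {f : E → F} (hf : Measurable f) :
    Exchangeable (fun k ω => f (Z k ω)) P := fun π =>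
  (h π).comp (u := fun (z : Fin N → E) (k : Fin N) => f (z k))
    (measurable_pi_lambda _ fun k => hf.comp (measurable_pi_apply k))

theorem identDistrib {N : ℕ} {Z : Fin (N + 1) → Ω → E} (h : Exchangeable Z P) (k : Fin (N + 1)) :
    IdentDistrib (Z k) (Z 0) P P := by
  simpa using! (h (Equiv.swap 0 k)).comp (measurable_pi_apply 0)

end Exchangeable

namespace AssimilationProblem

variable {Ω : Type*} [MeasurableSpace Ω] {P : Measure Ω} [IsProbabilityMeasure P] {n : ℕ}
  {S : AssimilationProblem n} {U₀ : ℕ → Ω → EuclideanSpace ℝ (Fin n)}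
  {D : (m : ℕ) → ℕ → Ω → EuclideanSpace ℝ (Fin (S.obsDim m))}

theorem convergesInEveryLp_analysis (hR : ∀ m, (S.R m).PosDef)
    (h_indep : iIndep (S.inputSpace U₀ D) P)
    (hU₀_meas : ∀ k, Measurable (U₀ k)) (hD_meas : ∀ m k, Measurable (D m k))
    (hU₀ : ∀ k l, P.map (U₀ k) = P.map (U₀ l)) (hD : ∀ m k l, P.map (D m k) = P.map (D m l))
    (hU₀_Lp : ∀ p : ENNReal, 1 ≤ p → p ≠ ⊤ → MemLp (U₀ 0) p P)
    (hD_Lp : ∀ m, ∀ p : ENNReal, 1 ≤ p → p ≠ ⊤ → MemLp (D m 0) p P) (m : ℕ) :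
    ConvergesInEveryLp (fun N => S.randomAnalysis U₀ D (N + 1) m 0)
      (S.refAnalysis P U₀ D m 0) P := by
  induction m with
  | zero => exact ConvergesInEveryLp.of_memLp hU₀_Lp
  | succ m ih =>
    let V : (N : ℕ) → Fin (N + 1) → Ω → EuclideanSpace ℝ (Fin n) := fun N k ω =>
      S.model m (S.randomAnalysis U₀ D (N + 1) m k ω)
    let W : ℕ → Ω → EuclideanSpace ℝ (Fin n) := fun k ω => S.model m (S.refAnalysis P U₀ D m k ω)
    have hmodel := S.measurable_model m
    have hV : ∀ N k, Measurable (V N k) := fun N k =>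
      hmodel.comp (S.measurable_enkfAnalysis (fun k : Fin (N + 1) => hU₀_meas k)
        (fun l (k : Fin (N + 1)) => hD_meas l k) m k)
    have hVW : ConvergesInEveryLp (fun N => V N 0) (W 0) P := ih.model S m
    have hident : ∀ N (k : Fin (N + 1)),
        -- Exchangeability must be that of the pairs: the differences `V N k - W k` have to be
        -- identically distributed, not only each term.
        IdentDistrib (fun ω => (V N k ω, W k ω)) (fun ω => (V N 0 ω, W 0 ω)) P P := fun N k =>
      ((exchangeable_analysis h_indep hU₀_meas hD_meas hU₀ hD (N + 1) m).comp
        (hmodel.prodMap hmodel)).identDistrib k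
    have hindep : Pairwise fun k l => IndepFun (W k) (W l) P := fun k l hkl =>
      (indepFun_refAnalysis h_indep hU₀_meas hD_meas m hkl).comp hmodel hmodel
    have hgain := ConvergesInEveryLp.kalmanGain (S.H m) (hR m)
      (fun N ω => sampleCov_posSemidef fun k => V N k ω)
      (covMat_posSemidef (hVW.memLp_limit one_le_two (by simp)))
      (fun N => measurable_sampleCov (hV N))
      (ConvergesInEveryLp.sampleCov hVW hident hindep)
    exact hVW.add (ConvergesInEveryLp.matVec hgain
      ((ConvergesInEveryLp.of_memLp (hD_Lp m)).sub
        (ConvergesInEveryLp.matVec (B := fun _ => S.H m)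
          (fun _ _ => ConvergesInEveryLp.const _) hVW)))

end AssimilationProblem

theorem mainTheorem1 {Ω : Type*} [MeasurableSpace Ω] (P : Measure Ω) [IsProbabilityMeasure P]
    {n : ℕ} (S : AssimilationProblem n) (hR : ∀ m, (S.R m).PosDef)
    (μ₀ : EuclideanSpace ℝ (Fin n)) (Q₀ : Matrix (Fin n) (Fin n) ℝ) (hQ₀ : Q₀.PosSemidef)
    (U₀ : ℕ → Ω → EuclideanSpace ℝ (Fin n))
    (D : (m : ℕ) → ℕ → Ω → EuclideanSpace ℝ (Fin (S.obsDim m)))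
    (hU₀_meas : ∀ k, Measurable (U₀ k)) (hD_meas : ∀ m k, Measurable (D m k))
    (hU₀_law : ∀ k, HasLaw (U₀ k) (multivariateGaussian μ₀ Q₀) P)
    (hD_law : ∀ m k, HasLaw (D m k) (multivariateGaussian (S.d m) (S.R m)) P)
    -- all the initial members and all the perturbed data vectors are mutually independent
    (h_indep : iIndep (fun i : ℕ ⊕ ℕ × ℕ => Sum.elim
      (fun k => MeasurableSpace.comap (U₀ k) inferInstance)
      (fun mk : ℕ × ℕ => MeasurableSpace.comap (D mk.1 mk.2) inferInstance) i) P)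
    (m : ℕ) :
    (∀ N : ℕ,
      Exchangeable (fun (k : Fin N) ω =>
        (S.randomForecast U₀ D N m k ω, S.refForecast P U₀ D m k ω)) P ∧
      Exchangeable (fun (k : Fin N) ω =>
        (S.randomAnalysis U₀ D N m k ω, S.refAnalysis P U₀ D m k ω)) P) ∧
    ∀ p : ENNReal, 1 ≤ p → p ≠ ⊤ →
      ConvergesInLp (fun N => S.randomForecast U₀ D (N + 1) m 0) (S.refForecast P U₀ D m 0) p P ∧
      ConvergesInLp (fun N => S.randomAnalysis U₀ D (N + 1) m 0) (S.refAnalysis P U₀ D m 0) p P := by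
  have hU₀ : ∀ k l, P.map (U₀ k) = P.map (U₀ l) := fun k l => by
    rw [(hU₀_law k).map_eq, (hU₀_law l).map_eq]
  have hD : ∀ m k l, P.map (D m k) = P.map (D m l) := fun m k l => by
    rw [(hD_law m k).map_eq, (hD_law m l).map_eq]
  have hex : ∀ m N, Exchangeable (fun (k : Fin N) ω =>
      (S.randomAnalysis U₀ D N m k ω, S.refAnalysis P U₀ D m k ω)) P := fun m N =>
    AssimilationProblem.exchangeable_analysis h_indep hU₀_meas hD_meas hU₀ hD N m
  have hconv := AssimilationProblem.convergesInEveryLp_analysis hR h_indep hU₀_meas hD_meas hU₀ hD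
    (fun _ _ hp => (hU₀_law 0).memLp_of_isGaussian hp)
    (fun m _ _ hp => (hD_law m 0).memLp_of_isGaussian hp)
  refine ⟨fun N => ⟨?_, hex m N⟩, fun p hp hp' => ⟨?_, hconv m p hp hp'⟩⟩
  -- In cycle `0` forecast and analysis are both the initial ensemble; later forecasts are model
  -- images of the preceding analysis.
  · cases m with
    | zero => exact hex 0 N
    | succ m => exact (hex m N).comp ((S.measurable_model m).prodMap (S.measurable_model m))
  · cases m with
    | zero => exact hconv 0 p hp hp'
    | succ m => exact (hconv m).model S m p hp hp'
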